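/- **Setting.** Let $\mathcal L$ be a countable first-order language with a binary relation symbol $<$, let $\theta$ be a strongly inaccessible cardinal (uncountable, regular, strong limit), and let $M$ be a $\theta$-like $\mathcal L$-structure: $<$ is interpreted by a linear order, $|M|=\theta$, and every element of $M$ has fewer than $\theta$ predecessors. Let $M$ be expanded to a structure for a language $\mathcal L^S\supseteq\mathcal L$ with Skolem functions: for every $\mathcal L$-formula $\varphi(x_1,\dots,x_n,y)$ there is an $n$-ary function symbol $f$ of $\mathcal L^S$ with $M\models\forall\bar x\,(\exists y\,\varphi(\bar x,y)\to\varphi(\bar x,f(\bar x)))$. Let $M=\bigcup_{i<\theta}M_i$, where $\langle M_i\mid i<\theta\rangle$ is a strictly increasing chain of $\mathcal L^S$-submodels that are elementary for $\mathcal L$, $M_j$ is an end extension of $M_i$ for $i<j$ (every element of $M_j\setminus M_i$ is larger than every element of $M_i$), and $M_\delta=\bigcup_{i<\delta}M_i$ for limit $\delta<\theta$. For $a\in M$ let $F(a)$ be the least $i<\theta$ with $a\in M_i$. **Superlarge sets.** For $X\subseteq M$ let $[X]^r$ be the set of increasing $r$-sequences from $X$, and let $[X]^\mu$, for a cardinal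 $\mu$ in the role of a size, be the set of subsets of $X$ of cardinality $\mu$. Let $r,s\ge 1$. For $f\ge 0$ let $[F]^{r,f}$ be the set of all $f$-tuples $\mathbf x=\langle\langle x_{11},\dots,x_{1r}\rangle,\dots,\langle x_{f1},\dots,x_{fr}\rangle\rangle$ of elements of $[M]^r$ such that $F(x_{ij})=F(x_{il})$ for all $i,j,l$ and $F(x_{11})<F(x_{21})<\dots<F(x_{f1})$; for $A\subseteq M$ let $[F|A]^{r,f}$ be the set of those $\mathbf x\in[F]^{r,f}$ with all $x_{ij}\in A$. For $1\le e\le s$ and $S\subseteq[F]^{r,s}$, in the game $G(S,e)$ players I and II move alternately, $e$ times each, I first. In his $k$-th move I chooses a cardinal $\mu_k<\theta$. In his $k$-th move, $k<e$, II chooses an ordinal $\beta_k<\theta$; in his last move he chooses a sequence $\langle\beta_{e+i}\mid i<\theta\rangle$ of ordinals $<\theta$. II wins if $\beta_1<\beta_2<\dots<\beta_e<\dots<\beta_{e+i}<\cdots$ $(i<\theta)$ and there are sets $X_k\subseteq F^{-1}(\beta_k)$ with $|X_k|=\mu_k$ for $1\le k\le e$, and sets $X_{e+i}\subseteq F^{-1}(\beta_{e+i})$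 for $1\le i<\theta$, such that $\sup\{|X_{e+i}| : 1\le i<\theta\}=\theta$ and $$\prod_{1\le k\le e}[X_k]^r\times\Big[F\,\Big|\bigcup_{1\le i<\theta}X_{e+i}\Big]^{r,\,s-e}\subseteq S$$ (for $s=e$ the second factor is omitted). $S$ is called *$e$-superlarge* if II has a winning strategy in $G(S,e)$. **Sentences of type $\Sigma^*(iv)$.** Let $C^*=\{c_{ij}\mid i,j\ge 1\}$ be new constant symbols indexed by pairs of positive integers. A sentence $\sigma$ of type $\Sigma^*(iv)$ is an $\mathcal L^S(C^*)$-sentence $$\tau(c_{i_1j_1},\dots,c_{i_nj_n})<c_{uv}\ \rightarrow\ \tau(c_{i_1j_1},\dots,c_{i_nj_n})=\tau(c_{i_1j_1},\dots,c_{i_mj_m},c_{i_{m+1}l_{m+1}},\dots,c_{i_nl_n}),$$ where $n\ge 1$, $\tau(v_1,\dots,v_n)$ is a term of $\mathcal L^S$, $u<i_n$, $m\ge 0$ is the least integer with $i_{m+1}>u$, and both sequences of constants to which $\tau$ is applied are strictly increasing in the lexicographic order of their indices. Put $\iota(\sigma)=i_n$. If $i\le s$ and $j\le r$ for all the constants $c_{ij}$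 displayed in $\sigma$, then for $\mathbf a\in[F]^{r,s}$ we write $M\models\sigma(\mathbf a)$ if $\sigma$ holds in $M$ when every $c_{ij}$ is interpreted by $a_{ij}$. **Proposition.** Let $1\le e\le s$ and let $S\subseteq[F]^{r,s}$ be an $e$-superlarge set. Let $\sigma$ be a sentence of type $\Sigma^*(iv)$ such that $i\le s$ and $j\le r$ for all $c_{ij}$ occurring in $\sigma$, and let $\iota(\sigma)=e'\ge e$. Then there is an $e'$-superlarge set $S'\subseteq S$ such that $M\models\sigma(\mathbf a)$ for every $\mathbf a\in S'$. -/

import Mathlib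

open FirstOrder Cardinal

universe u v w v' w'

namespace KeislerModels

/-! ### The model, its Skolem expansion and the elementary end extension chain -/

section Model

/-- A linearly ordered set is `θ`-like if it has cardinality `θ` and each of its elements has fewer
than `θ` predecessors. -/
def IsLike (θ : Cardinal.{u}) (M : Type u) [LinearOrder M] : Prop :=
  #M = θ ∧ ∀ a : M, #(Set.Iio a) < θ

variable {L : FirstOrder.Language.{v, w}} {LS : FirstOrder.Language.{v', w'}}

/-- `M` satisfies the Skolem theory of `L` in the expanded language `LS`: for every `L`-formula
`φ(x₁, …, xₙ, y)` there is an `n`-ary function symbol `f` of `LS` such that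
`M ⊨ ∀ x₁ … xₙ (∃ y φ(x₁, …, xₙ, y) → φ(x₁, …, xₙ, f(x₁, …, xₙ)))`. -/
def HasSkolemFunctions (_ι : L →ᴸ LS) (M : Type u) [L.Structure M] [LS.Structure M] : Prop :=
  ∀ (n : ℕ) (φ : L.BoundedFormula Empty (n + 1)), ∃ f : LS.Functions n, ∀ x : Fin n → M,
    (∃ y : M, φ.Realize default (Fin.snoc x y : Fin (n + 1) → M)) →
      φ.Realize default
        (Fin.snoc x (FirstOrder.Language.Structure.funMap f x) : Fin (n + 1) → M)

/-- `⟨N i | i < θ⟩` is a continuous elementary end extension chain of `LS`-submodels of `M` with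
union `M`. Only the values `N i` with `i < θ` matter. Elementarity is required for the formulas
of `L`; each `N i` is a submodel for the larger language `LS`. -/
structure IsElementaryEndChain (ι : L →ᴸ LS) {M : Type u} [LinearOrder M] [L.Structure M]
    [LS.Structure M] [ι.IsExpansionOn M] (θ : Cardinal.{u})
    (N : Ordinal.{u} → LS.Substructure M) : Prop where
  elementary : ∀ i < θ.ord, (ι.substructureReduct (N i)).IsElementary
  strictMono : ∀ i j, i < j → j < θ.ord → N i < N j
  endExtension : ∀ i j, i < j → j < θ.ord → ∀ a ∈ N i, ∀ b ∈ N j, b ∉ N i → a < b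
  continuous : ∀ i < θ.ord, Order.IsSuccLimit i → ∀ a ∈ N i, ∃ j < i, a ∈ N j
  exhausts : ∀ a : M, ∃ i < θ.ord, a ∈ N i

/-- The rank function `F : M → θ` of a chain: `F a` is the least `i < θ` with `a ∈ N i`. -/
noncomputable def rank {M : Type u} [LS.Structure M] (θ : Cardinal.{u})
    (N : Ordinal.{u} → LS.Substructure M) (a : M) : Ordinal.{u} :=
  sInf {i | i < θ.ord ∧ a ∈ N i}

end Model

/-! ### Superlarge sets -/

section Superlarge

variable {M : Type u} [LinearOrder M]

/-- The set `[F]^{r,s}` of all `s`-tuples of increasing `r`-sequences of elements of `M` such that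
`F` is constant on every row and `F` increases strictly from each row to the next. -/
def rowTuples (F : M → Ordinal.{u}) (r s : ℕ) : Set (Fin s → Fin r → M) :=
  {x | (∀ i, StrictMono (x i)) ∧ (∀ i j l, F (x i j) = F (x i l)) ∧
    ∀ i i' j j', i < i' → F (x i j) < F (x i' j')}

/-- The set `[F|A]^{r,s}` of those tuples in `[F]^{r,s}` all of whose entries are in `A`. -/
def rowTuplesIn (F : M → Ordinal.{u}) (A : Set M) (r s : ℕ) : Set (Fin s → Fin r → M) :=
  {x | x ∈ rowTuples F r s ∧ ∀ i j, x i j ∈ A}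

/-- The product `∏_{i ≤ e} [X i]^r × [F|A]^{r,f}`, `f = s - e`, as a set of `s`-tuples of
`r`-sequences: the first `e` rows are increasing sequences from the respective sets `X i`, and the
remaining rows form an element of `[F|A]^{r,f}`. For `f = 0` only the first factor remains. -/
def rowProduct (F : M → Ordinal.{u}) {r s e : ℕ} (X : Fin e → Set M) (A : Set M) :
    Set (Fin s → Fin r → M) :=
  {x | (∀ (i : Fin s) (h : i.val < e), StrictMono (x i) ∧ ∀ j, x i j ∈ X ⟨i.val, h⟩) ∧
    (fun k : Fin (s - e) => x ⟨e + k.val, by omega⟩) ∈ rowTuplesIn F A r (s - e)}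

/-- The winning condition of the game `G(S, e)` for player II, for a finished play: player I has
played the cardinals `μ 0, …, μ (e - 1)` (that is, `μ₁, …, μ_e`), player II the ordinals
`β 0, …, β (e - 1)` (that is, `β₁, …, β_e`) together with the ordinals `γ i` for `1 ≤ i < θ`
(that is, `β_{e+i}`); the last move of II is the sequence `⟨β_{e+i} | i < θ⟩`, which consists of
`β_e` and of these `γ i`. The ordinals played must be smaller than `θ`. -/
structure PlayerTwoWins (θ : Cardinal.{u}) (F : M → Ordinal.{u}) {r s : ℕ} (e : ℕ)
    (S : Set (Fin s → Fin r → M)) (μ : Fin e → Cardinal.{u}) (β : Fin e → Ordinal.{u})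
    (γ : Ordinal.{u} → Ordinal.{u}) : Prop where
  head_lt : ∀ k, β k < θ.ord
  tail_lt : ∀ i, 1 ≤ i → i < θ.ord → γ i < θ.ord
  head_increasing : StrictMono β
  head_lt_tail : ∀ k i, 1 ≤ i → i < θ.ord → β k < γ i
  tail_increasing : ∀ i j, 1 ≤ i → i < j → j < θ.ord → γ i < γ j
  exists_sets : ∃ (X : Fin e → Set M) (Y : Ordinal.{u} → Set M),
    (∀ k, X k ⊆ F ⁻¹' {β k} ∧ #(X k) = μ k) ∧
    (∀ i, 1 ≤ i → i < θ.ord → Y i ⊆ F ⁻¹' {γ i}) ∧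
    IsLUB {κ : Cardinal.{u} | ∃ i, 1 ≤ i ∧ i < θ.ord ∧ κ = #(Y i)} θ ∧
    rowProduct F X (⋃ i ∈ {i : Ordinal.{u} | 1 ≤ i ∧ i < θ.ord}, Y i) ⊆ S

/-- A strategy of player II in a game with `e` moves of each player. The ordinal played in the
`k`-th move depends on the first `k` cardinals played by I; the ordinals that II adds in the last
move depend on all the cardinals played by I. -/
structure Strategy (e : ℕ) where
  head : (k : Fin e) → (Fin (k.val + 1) → Cardinal.{u}) → Ordinal.{u}
  tail : (Fin e → Cardinal.{u}) → Ordinal.{u} → Ordinal.{u}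

/-- The strategy wins `G(S, e)` for player II, whichever cardinals `< θ` player I chooses. -/
def Strategy.IsWinning {e : ℕ} (str : Strategy.{u} e) (θ : Cardinal.{u}) (F : M → Ordinal.{u})
    {r s : ℕ} (S : Set (Fin s → Fin r → M)) : Prop :=
  ∀ μ : Fin e → Cardinal.{u}, (∀ k, μ k < θ) →
    PlayerTwoWins θ F e S μ (fun k => str.head k (fun q => μ (Fin.castLE k.isLt q))) (str.tail μ)

/-- `S ⊆ [F]^{r,s}` is `e`-superlarge, `1 ≤ e ≤ s`: player II has a winning strategy for
`G(S, e)`. -/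
def IsSuperlarge (θ : Cardinal.{u}) (F : M → Ordinal.{u}) {r s : ℕ} (e : ℕ)
    (S : Set (Fin s → Fin r → M)) : Prop :=
  1 ≤ e ∧ e ≤ s ∧ S ⊆ rowTuples F r s ∧ ∃ str : Strategy.{u} e, str.IsWinning θ F S

end Superlarge

/-! ### The sentences of type `Σ*(iv)` -/

section Sentences

/-- The term `τ(c_{p₁}, …, c_{pₙ})` of `LS(C*)`, where `C* = {c_{ij}}` and the constant symbol
`c_{ij}` is indexed by the pair `(i, j)`. -/
def substConstants {LS : FirstOrder.Language.{v', w'}} {n : ℕ} (τ : LS.Term (Fin n)) (p : Fin n → ℕ × ℕ) :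
    LS[[ℕ × ℕ]].Term (Empty ⊕ Fin 0) :=
  ((LS.lhomWithConstants (ℕ × ℕ)).onTerm τ).subst fun k => (LS.con (p k)).term

/-- The data of a sentence of type `Σ*(iv)`: a term `τ(v₁, …, vₙ)` of `LS` with `n ≥ 1`, a strictly
increasing (in the lexicographic order of the indices) sequence of constants
`c_{i₁j₁}, …, c_{iₙjₙ}`, a constant `c_{uv}` with `u < iₙ`, and numbers `l`. Here `m` is the
number of `k` with `i_k ≤ u`; as the `i_k` do not decrease, `i_k ≤ u` holds exactly for `k ≤ m`.
The constants `c_{i_k j_k}` with `k ≤ m` are kept, those with `k > m` become `c_{i_k l_k}`;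
the resulting sequence has to be strictly increasing too. All indices start from `1`. -/
structure SigmaIV (LS : FirstOrder.Language.{v', w'}) where
  /-- One less than the number of variables. -/
  n : ℕ
  τ : LS.Term (Fin (n + 1))
  i : Fin (n + 1) → ℕ
  j : Fin (n + 1) → ℕ
  u : ℕ
  v : ℕ
  l : Fin (n + 1) → ℕ
  i_pos : ∀ k, 1 ≤ i k
  j_pos : ∀ k, 1 ≤ j k
  u_pos : 1 ≤ u
  v_pos : 1 ≤ v
  l_pos : ∀ k, 1 ≤ l k
  u_lt : u < i (Fin.last n)
  left_increasing : StrictMono fun k => toLex (i k, j k)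
  right_increasing : StrictMono fun k => toLex (i k, if i k ≤ u then j k else l k)

namespace SigmaIV

variable {LS : FirstOrder.Language.{v', w'}} (σ : SigmaIV LS)

/-- `ι(σ) = iₙ`. -/
def iota : ℕ := σ.i (Fin.last σ.n)

/-- The indices of the constants on the left side. -/
def leftIndex (k : Fin (σ.n + 1)) : ℕ × ℕ := (σ.i k, σ.j k)

/-- The indices of the constants on the right side. -/
def rightIndex (k : Fin (σ.n + 1)) : ℕ × ℕ := (σ.i k, if σ.i k ≤ σ.u then σ.j k else σ.l k)

/-- The sentence `τ(c_{i₁j₁}, …, c_{iₙjₙ}) < c_{uv} →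
τ(c_{i₁j₁}, …, c_{iₙjₙ}) = τ(c̄, c_{i_{m+1}l_{m+1}}, …, c_{iₙlₙ})` of `LS(C*)`, where
`c̄ = ⟨c_{i₁j₁}, …, c_{i_m j_m}⟩`. -/
def sentence (lt : LS.Relations 2) : LS[[ℕ × ℕ]].Sentence :=
  (((LS.lhomWithConstants (ℕ × ℕ)).onRelation lt).boundedFormula₂
      (substConstants σ.τ σ.leftIndex) (LS.con (σ.u, σ.v)).term).imp
    ((substConstants σ.τ σ.leftIndex).bdEqual (substConstants σ.τ σ.rightIndex))

/-- Every `c_{ij}` occurring in `σ` has `i ≤ s` and `j ≤ r`. -/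
def InRange (r s : ℕ) : Prop :=
  (∀ k, (σ.leftIndex k).1 ≤ s ∧ (σ.leftIndex k).2 ≤ r) ∧
  (∀ k, (σ.rightIndex k).1 ≤ s ∧ (σ.rightIndex k).2 ≤ r) ∧ σ.u ≤ s ∧ σ.v ≤ r

end SigmaIV

/-- `M ⊨ φ(𝐚)`: the `LS(C*)`-sentence `φ` holds in `M` when `c_{ij}` is interpreted by `a_{ij}` for
`1 ≤ i ≤ s`, `1 ≤ j ≤ r` (rows and columns of `𝐚` are numbered from `0` here); the other constants
are interpreted in an arbitrary way, which makes no difference if they do not occur in `φ`. -/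
def Holds {LS : FirstOrder.Language.{v', w'}} {M : Type u} [LS.Structure M] {r s : ℕ}
    (φ : LS[[ℕ × ℕ]].Sentence) (a : Fin s → Fin r → M) : Prop :=
  ∀ c : ℕ × ℕ → M, (∀ (i : Fin s) (j : Fin r), c (i.val + 1, j.val + 1) = a i j) →
    letI := FirstOrder.Language.constantsOn.structure c
    M ⊨ φ

end Sentences

end KeislerModels

/-!
The sentence `σ` says that a value of `τ` below `c_{uv}` does not depend on the columns of the
arguments in the rows above `u`. As `F ⁻¹' Set.Iic β` is small for `β < θ`, the sets that belong
to the last move of player II remain large far out, so that one of them can answer one more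
cardinal; hence `S` is `ι(σ)`-superlarge. In the game of this length player II pretends that
player I has played larger cardinals, so large that the Erdős–Rado theorem applies to each of the
resulting sets and to every colouring with as many colours as there are functions from the tuples
with entries of rank at most `β` to the elements of rank at most `β` and one further colour, where
`β` is the ordinal played before. Starting with the last row, the sets are then shrunk, to the
sizes that player I has asked for, until the colour of a tuple depends on its rows up to `u` only.
The colour of a tuple is the value of `τ` if its rank is at most that of the row `u`, and the
further colour otherwise. By monotonicity of `F`, a value of `τ` below `c_{uv}` is a colour of the
first kind.
-/

namespace KeislerModels

section PartitionRelation

theorem power_lt_of_isStrongLimit {θ κ ν : Cardinal.{u}} (hθ : θ.IsStrongLimit) (hκ : κ < θ)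
    (hν : ν < θ) : κ ^ ν < θ :=
  calc κ ^ ν ≤ (2 ^ κ) ^ ν := power_le_power_right (cantor κ).le
    _ = 2 ^ (κ * ν) := (power_mul ..).symm
    _ < θ := hθ.isStrongPrelimit (mul_lt_of_lt hθ.aleph0_le hκ hν)

/-- The partition relation `μ → (κ)^p_ν` of Erdős and Rado. The colouring is defined on all finite
sets, but only its values on sets of size `p` matter. -/
def PartitionArrow (μ κ ν : Cardinal.{u}) (p : ℕ) : Prop :=
  ∀ X C : Type u, μ ≤ #X → #C ≤ ν → ∀ c : Finset X → C,
    ∃ H : Set X, #H = κ ∧ ∃ γ, ∀ t : Finset X, ↑t ⊆ H → t.card = p → c t = γ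

theorem PartitionArrow.mono {μ μ' κ ν ν' : Cardinal.{u}} {p : ℕ} (h : PartitionArrow μ κ ν p)
    (hμ : μ ≤ μ') (hν : ν' ≤ ν) : PartitionArrow μ' κ ν' p :=
  fun X C hX hC => h X C (hμ.trans hX) (hC.trans hν)

variable {W X C : Type u} [DecidableEq X]

/-- The point `z` is a copy of `x` over `A`: it lies outside `A` and it gets the same colours as `x`
over all finite subsets of `A`. -/
def IsCopyOver (c : Finset X → C) (A : Set X) (x z : X) : Prop :=
  z ∉ A ∧ ∀ t : Finset X, ↑t ⊆ A → c (insert z t) = c (insert x t)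

/-- The sequence along the well-order `W` each of whose terms is a chosen copy of `x` over the
earlier terms. A term for which there is no such copy has an arbitrary value. -/
noncomputable def copySeq [LinearOrder W] [WellFoundedLT W] [Nonempty X] (c : Finset X → C) (x : X)
    (ξ : W) : X :=
  Classical.epsilon (IsCopyOver c (Set.range fun η : Set.Iio ξ => copySeq c x η.1) x)
termination_by wellFounded_lt.wrap ξ
decreasing_by exact η.2

theorem injective_of_isCopyOver [LinearOrder W] {c : Finset X → C} {x : X} {a : W → X}
    (ha : ∀ ξ, IsCopyOver c (a '' Set.Iio ξ) x (a ξ)) : Function.Injective a :=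
  Function.Injective.of_lt_imp_ne fun ξ η hlt h => (ha η).1 ⟨ξ, hlt, h⟩

theorem colour_eq_of_isCopyOver [LinearOrder W] {c : Finset X → C} {x : X} {a : W → X}
    (ha : ∀ ξ, IsCopyOver c (a '' Set.Iio ξ) x (a ξ)) {p : ℕ} {t : Finset W}
    (ht : t.card = p + 1) :
    ∃ t₀ ⊆ t, t₀.card = p ∧ c (t.image a) = c (insert x (t₀.image a)) := by
  have hne : t.Nonempty := Finset.card_pos.1 (by omega)
  refine ⟨t.erase (t.max' hne), t.erase_subset _, ?_, ?_⟩
  · rw [Finset.card_erase_of_mem (t.max'_mem hne), ht, Nat.add_sub_cancel]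
  · rw [← (ha (t.max' hne)).2, ← Finset.image_insert, Finset.insert_erase (t.max'_mem hne)]
    rw [Finset.coe_image]
    exact Set.image_mono fun η hη => t.lt_max'_of_mem_erase_max' hne hη

variable [LinearOrder W] [WellFoundedLT W] [Nonempty X]

theorem copySeq_eq_epsilon (c : Finset X → C) (x : X) (ξ : W) :
    copySeq c x ξ = Classical.epsilon (IsCopyOver c (copySeq c x '' Set.Iio ξ) x) := by
  rw [copySeq, Set.image_eq_range]

theorem copySeq_congr {c : Finset X → C} {x y : X}
    (h : ∀ t : Finset W,
      c (insert x (t.image (copySeq c x))) = c (insert y (t.image (copySeq c y)))) :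
    (copySeq c x : W → X) = copySeq c y := by
  funext ξ
  induction ξ using WellFoundedLT.induction with
  | _ ξ ih =>
    have himage : copySeq c x '' Set.Iio ξ = copySeq c y '' Set.Iio ξ :=
      Set.image_congr ih
    have hcolour : ∀ t : Finset X, ↑t ⊆ copySeq c x '' Set.Iio ξ →
        c (insert x t) = c (insert y t) := by
      intro t ht
      obtain ⟨t, htξ, rfl⟩ := Finset.subset_set_image_iff.1 ht
      rw [h t, Finset.image_congr fun η hη => ih η (htξ hη)]
    rw [copySeq_eq_epsilon, copySeq_eq_epsilon, ← himage]
    congr 1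
    funext z
    exact propext <| and_congr_right fun _ =>
      forall₂_congr fun t ht => by rw [hcolour t ht]

/-- By `copySeq_congr` the sequences `copySeq c x` have too few terms altogether to cover `X`. A
point `x` outside all of them is a copy of itself over each initial segment of its own sequence, so
this sequence never breaks down. -/
theorem exists_forall_isCopyOver (hX : #(W × (Finset W → C)) < #X) (c : Finset X → C) :
    ∃ (x : X) (a : W → X), ∀ ξ, IsCopyOver c (a '' Set.Iio ξ) x (a ξ) := by
  obtain ⟨x, hx⟩ : ∃ x, ∀ y, ∀ ξ : W, copySeq c y ξ ≠ x := by
    by_contra! hcover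
    choose y ξ h using hcover
    refine hX.not_ge (mk_le_of_injective (f := fun x =>
      (ξ x, fun t : Finset W => c (insert (y x) (t.image (copySeq c (y x)))))) fun x x' hxx => ?_)
    obtain ⟨hξ, hpattern⟩ := Prod.mk.inj hxx
    rw [← h x, ← h x', copySeq_congr (congrFun hpattern), hξ]
  refine ⟨x, copySeq c x, fun ξ => ?_⟩
  have hself : IsCopyOver c (copySeq c x '' Set.Iio ξ) x x :=
    ⟨fun ⟨η, _, h⟩ => hx x η h, fun _ _ => rfl⟩
  rw [copySeq_eq_epsilon]
  exact Classical.epsilon_spec ⟨x, hself⟩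

end PartitionRelation

theorem PartitionArrow.succ {μ κ ν : Cardinal.{u}} {p : ℕ} (h : PartitionArrow μ κ ν p) :
    PartitionArrow (Order.succ (μ * ν ^ (2 ^ μ : Cardinal.{u}))) κ ν (p + 1) := by
  classical
  intro X C hX hC c
  let W : Type u := μ.ord.ToType
  have hW : #W = μ := mk_ord_toType μ
  have hcard : #(W × (Finset W → C)) < #X := by
    have hfinset : #(Finset W) ≤ 2 ^ μ := by
      rw [← hW, ← mk_set]
      exact mk_le_of_injective Finset.coe_injective
    have hν : ν ≠ 0 := ((mk_ne_zero_iff.2 ⟨c ∅⟩).bot_lt.trans_le hC).ne'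
    refine (Order.succ_le_iff.1 hX).trans_le' ?_
    rw [mk_prod, lift_id, lift_id, ← power_def, hW]
    gcongr
    exact (power_le_power_right hC).trans (power_le_power_left hν hfinset)
  have : Nonempty X := mk_ne_zero_iff.1 (zero_le.trans_lt hcard).ne'
  obtain ⟨x, a, ha⟩ := exists_forall_isCopyOver hcard c
  have hinj : Function.Injective a := injective_of_isCopyOver ha
  obtain ⟨H, hH, γ, hγ⟩ := h W C hW.ge hC fun t => c (insert x (t.image a))
  refine ⟨a '' H, by rw [mk_image_eq hinj, hH], γ, fun t ht htp => ?_⟩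
  obtain ⟨t, htH, rfl⟩ := Finset.subset_set_image_iff.1 ht
  rw [Finset.card_image_of_injective _ hinj] at htp
  obtain ⟨t₀, ht₀, ht₀p, hcolour⟩ := colour_eq_of_isCopyOver ha htp
  rw [hcolour, hγ t₀ ((Finset.coe_subset.2 ht₀).trans htH) ht₀p]

theorem exists_partitionArrow {θ κ ν : Cardinal.{u}} (hθ : θ.IsStrongLimit) (hκ : κ < θ)
    (hν : ν < θ) (p : ℕ) : ∃ μ < θ, PartitionArrow μ κ ν p := by
  induction p with
  | zero =>
    refine ⟨κ, hκ, fun X C hX _ c => ?_⟩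
    obtain ⟨H, hH⟩ := le_mk_iff_exists_set.1 hX
    exact ⟨H, hH, c ∅, fun t _ ht => by rw [Finset.card_eq_zero.1 ht]⟩
  | succ p ih =>
    obtain ⟨μ, hμ, harrow⟩ := ih
    refine ⟨_, hθ.isSuccLimit.succ_lt ?_, harrow.succ⟩
    exact mul_lt_of_lt hθ.aleph0_le hμ
      (power_lt_of_isStrongLimit hθ hν (hθ.isStrongPrelimit hμ))

section Homogeneity

variable {I : Type} [LinearOrder I] {M V : Type u} [LinearOrder M]

theorem eqOn_of_strictMonoOn_of_image_eq {Q : Finset I} {f g : I → M} (hf : StrictMonoOn f Q)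
    (hg : StrictMonoOn g Q) (h : f '' Q = g '' Q) : Set.EqOn f g Q := by
  have hf' : StrictMono ((Q : Set I).domRestrict f) := fun q q' => hf q.2 q'.2
  have hg' : StrictMono ((Q : Set I).domRestrict g) := fun q q' => hg q.2 q'.2
  rw [← Set.range_domRestrict, ← Set.range_domRestrict, hf'.range_inj hg'] at h
  exact fun q hq => congrFun h ⟨q, hq⟩

theorem PartitionArrow.exists_strictMonoOn [Nonempty V] {μ κ ν : Cardinal.{u}} {Q : Finset I}
    (h : PartitionArrow μ κ ν Q.card) {X : Set M} (hX : μ ≤ #X) (hV : #V ≤ ν)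
    {val : (I → M) → V} (hval : DependsOn val Q) :
    ∃ H ⊆ X, #H = κ ∧ ∃ γ, ∀ f, StrictMonoOn f Q → Set.MapsTo f Q H → val f = γ := by
  classical
  let IsColour (t : Finset X) (γ : V) : Prop :=
    ∃ f : I → M, StrictMonoOn f Q ∧ f '' Q = Subtype.val '' (t : Set X) ∧ val f = γ
  obtain ⟨H, hH, γ, hγ⟩ := h X V hX hV fun t => Classical.epsilon (IsColour t)
  refine ⟨Subtype.val '' H, Subtype.coe_image_subset X H,
    by rw [mk_image_eq Subtype.val_injective, hH], γ, fun f hf hfH => ?_⟩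
  have hfX : ∀ q : {q // q ∈ Q}, f q.1 ∈ X := fun q => Subtype.coe_image_subset X H (hfH q.2)
  let t : Finset X := Q.attach.image fun q : {q // q ∈ Q} => (⟨f q, hfX q⟩ : X)
  have hft : f '' Q = Subtype.val '' (t : Set X) := by
    ext x
    simpa [t] using fun q hq hqx => hqx ▸ hfX ⟨q, hq⟩
  have htH : ↑t ⊆ H := by
    rw [← Set.image_subset_image_iff Subtype.val_injective, ← hft]
    exact hfH.image_subset
  have htcard : t.card = Q.card := by
    rw [Finset.card_image_of_injective _ fun q q' hqq => Subtype.ext <|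
      hf.injOn q.2 q'.2 (congrArg Subtype.val hqq), Finset.card_attach]
  obtain ⟨g, hg, hgt, hgval⟩ : IsColour t (Classical.epsilon (IsColour t)) :=
    Classical.epsilon_spec ⟨val f, f, hf, hft, rfl⟩
  rw [← hγ t htH htcard, ← hgval]
  exact hval <| eqOn_of_strictMonoOn_of_image_eq hf hg (hft.trans hgt.symm)

/-- The family `b` is increasing within each row, where `row` assigns a row to each index. -/
def IsRowIncreasing {α : Type*} [Preorder α] {e : ℕ} (row : I → Fin e) (b : I → α) : Prop :=
  ∀ k, StrictMonoOn b {q | row q = k}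

variable [Fintype I] {e : ℕ} {row : I → Fin e}

theorem exists_homogeneous_row [Nonempty V] {k : Fin e} {B X : Set M} {μ κ : Cardinal.{u}}
    (h : PartitionArrow μ κ #(({q // row q < k} → B) → V) (Finset.univ.filter (row · = k)).card)
    (hX : μ ≤ #X) {val : (I → M) → V} (hval : DependsOn val {q | row q ≤ k}) :
    ∃ H ⊆ X, #H = κ ∧ ∃ val' : (I → M) → V, DependsOn val' {q | row q < k} ∧
      ∀ b, (∀ q, row q < k → b q ∈ B) → (∀ q, row q = k → b q ∈ H) →
        StrictMonoOn b {q | row q = k} → val b = val' b := by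
  classical
  let extend (low : {q // row q < k} → B) (f : I → M) : I → M :=
    fun q => if hq : row q < k then low ⟨q, hq⟩ else f q
  have hdep : DependsOn (fun f low => val (extend low f)) (Finset.univ.filter (row · = k)) := by
    intro f g hfg
    funext low
    refine hval fun q (hq : row q ≤ k) => ?_
    by_cases hlt : row q < k
    · simp only [extend, dif_pos hlt]
    · simpa only [extend, dif_neg hlt] using hfg q (by simpa using le_antisymm hq (not_lt.1 hlt))
  obtain ⟨H, hHX, hH, γ, hγ⟩ := h.exists_strictMonoOn hX le_rfl hdep
  refine ⟨H, hHX, hH, fun b => if hb : ∀ q, row q < k → b q ∈ B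
    then γ fun q => ⟨b q, hb q q.2⟩ else Classical.arbitrary V, fun b b' hbb => ?_,
    fun b hb hbH hmono => ?_⟩
  · have hB : (∀ q, row q < k → b q ∈ B) ↔ ∀ q, row q < k → b' q ∈ B :=
      forall₂_congr fun q hq => by rw [hbb q hq]
    by_cases hb : ∀ q, row q < k → b q ∈ B
    · simp only [dif_pos hb, dif_pos (hB.1 hb)]
      congr 1
      exact funext fun q => Subtype.ext (hbb q q.2)
    · simp only [dif_neg hb, dif_neg (hB.not.1 hb)]
  · have hself : extend (fun q => ⟨b q, hb q q.2⟩) b = b := by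
      funext q
      simp only [extend, dite_eq_ite, ite_self]
    simp only [dif_pos hb, ← hγ b (by simpa using hmono) fun q hq => hbH q (by simpa using hq),
      hself]

/-- The rows above `u` are treated from the top one downwards: the colouring left over from a row
depends on the lower rows only. -/
theorem exists_homogeneous_rows [Nonempty V] {u : Fin e} {X : Fin e → Set M}
    {κ : Fin e → Cardinal.{u}} (hκ : ∀ k, κ k ≤ #(X k))
    (hX : ∀ k, u < k → ∃ B : Set M, (∀ i < k, X i ⊆ B) ∧
      PartitionArrow #(X k) (κ k) #(({q // row q < k} → B) → V)
        (Finset.univ.filter (row · = k)).card)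
    {k : ℕ} (huk : u < k) (hke : k ≤ e) {val : (I → M) → V}
    (hval : DependsOn val {q | row q < k}) :
    ∃ H : Fin e → Set M, (∀ i, H i ⊆ X i ∧ #(H i) = κ i) ∧ ∀ b b',
      (∀ q, row q < k → b q ∈ H (row q)) → (∀ q, row q < k → b' q ∈ H (row q)) →
      IsRowIncreasing row b → IsRowIncreasing row b' →
      (∀ q, row q ≤ u → b q = b' q) → val b = val b' := by
  induction k, Nat.succ_le_iff.2 huk using Nat.le_induction generalizing val with
  | base =>
    choose H hH using fun i => le_mk_iff_exists_subset.1 (hκ i)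
    exact ⟨H, hH, fun b b' _ _ _ _ hbb => hval fun q hq => hbb q (Nat.lt_succ_iff.1 hq)⟩
  | succ k huk' ih =>
    let top : Fin e := ⟨k, hke⟩
    obtain ⟨B, hXB, harrow⟩ := hX top huk'
    obtain ⟨Htop, hHtopX, hHtop, val', hval', hreduce⟩ :=
      exists_homogeneous_row harrow le_rfl fun b b' hbb =>
        hval fun q hq => hbb q (Nat.lt_succ_iff.1 hq)
    obtain ⟨H, hH, hhom⟩ := ih huk' (Nat.le_of_succ_le hke) hval'
    have hmem : ∀ b : I → M, (∀ q, row q < k + 1 → b q ∈ Function.update H top Htop (row q)) →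
        (∀ q, row q < k → b q ∈ H (row q)) ∧ ∀ q, row q = top → b q ∈ Htop := by
      refine fun b hb => ⟨fun q hq => ?_, fun q hq => ?_⟩
      · simpa [(Fin.ne_of_lt hq : row q ≠ top)] using hb q (by omega)
      · simpa [hq] using hb q (by simp [hq, top])
    have hval_eq : ∀ b : I → M, (∀ q, row q < k + 1 → b q ∈ Function.update H top Htop (row q)) →
        IsRowIncreasing row b → val b = val' b := fun b hb hinc =>
      hreduce b (fun q hq => hXB _ hq ((hH _).1 ((hmem b hb).1 q hq))) (hmem b hb).2 (hinc top)
    refine ⟨Function.update H top Htop, fun i => ?_, fun b b' hb hb' hinc hinc' hbb => ?_⟩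
    · obtain rfl | hi := eq_or_ne i top
      · simpa using ⟨hHtopX, hHtop⟩
      · simpa [hi] using hH i
    · rw [hval_eq b hb hinc, hval_eq b' hb' hinc']
      exact hhom b b' (hmem b hb).1 (hmem b' hb').1 hinc hinc' hbb

theorem exists_homogeneous_term {u : Fin e} {X : Fin e → Set M} {κ : Fin e → Cardinal.{u}}
    (t : (I → M) → M) {D : Set M} (hκ : ∀ k, κ k ≤ #(X k))
    (hX : ∀ k, u < k → ∃ B : Set M, (∀ i < k, X i ⊆ B) ∧
      PartitionArrow #(X k) (κ k) #(({q // row q < k} → B) → Option D)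
        (Finset.univ.filter (row · = k)).card) :
    ∃ H : Fin e → Set M, (∀ i, H i ⊆ X i ∧ #(H i) = κ i) ∧ ∀ b b',
      (∀ q, b q ∈ H (row q)) → (∀ q, b' q ∈ H (row q)) →
      IsRowIncreasing row b → IsRowIncreasing row b' →
      (∀ q, row q ≤ u → b q = b' q) → t b ∈ D → t b = t b' := by
  classical
  let val (b : I → M) : Option D := if h : t b ∈ D then some ⟨t b, h⟩ else none
  have hdep : DependsOn val {q | row q < e} := fun b b' hbb =>
    congrArg val (funext fun q => hbb q (row q).isLt)
  obtain ⟨H, hH, hhom⟩ := exists_homogeneous_rows hκ hX u.isLt le_rfl hdep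
  refine ⟨H, hH, fun b b' hb hb' hinc hinc' hbb hD => ?_⟩
  have hval := hhom b b' (fun q _ => hb q) (fun q _ => hb' q) hinc hinc' hbb
  by_cases hD' : t b' ∈ D
  · simpa [val, hD, hD'] using hval
  · simp [val, hD, hD'] at hval

theorem exists_partitionArrow_option {θ κ : Cardinal.{u}} (hθ : θ.IsStrongLimit) (hκ : κ < θ)
    (J : Type) [Finite J] {B : Set V} (hB : #B < θ) (p : ℕ) :
    ∃ μ < θ, ∀ D ⊆ B, PartitionArrow μ κ #((J → B) → Option D) p := by
  have hJB : #(J → B) < θ := by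
    rw [mk_arrow, lift_id']
    have hJ : lift #J < ℵ₀ := lift_lt_aleph0.2 mk_lt_aleph0
    exact power_lt_of_isStrongLimit hθ hB (hJ.trans_le hθ.aleph0_le)
  have hcolours : #((J → B) → Option B) < θ := by
    rw [← power_def]
    refine power_lt_of_isStrongLimit hθ ?_ hJB
    rw [mk_option]
    exact add_lt_of_lt hθ.aleph0_le hB (one_lt_aleph0.trans_le hθ.aleph0_le)
  obtain ⟨μ, hμ, harrow⟩ := exists_partitionArrow hθ hκ hcolours p
  refine ⟨μ, hμ, fun D hD => harrow.mono le_rfl ?_⟩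
  rw [← power_def, ← power_def, mk_option, mk_option]
  exact power_le_power_right (add_le_add (mk_le_mk_of_subset hD) le_rfl)

end Homogeneity

section Game

variable {M : Type u} {θ : Cardinal.{u}} {F : M → Ordinal.{u}} {r s e : ℕ}

/-- The requirements on the last move `γ` of player II and on the sets `Y i` chosen for it in the
winning condition of the game, as far as they do not involve the earlier moves. -/
structure IsLargeTail (θ : Cardinal.{u}) (F : M → Ordinal.{u}) (γ : Ordinal.{u} → Ordinal.{u})
    (Y : Ordinal.{u} → Set M) : Prop where
  lt : ∀ i, 1 ≤ i → i < θ.ord → γ i < θ.ord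
  increasing : ∀ i j, 1 ≤ i → i < j → j < θ.ord → γ i < γ j
  subset : ∀ i, 1 ≤ i → i < θ.ord → Y i ⊆ F ⁻¹' {γ i}
  isLUB : IsLUB {κ : Cardinal.{u} | ∃ i, 1 ≤ i ∧ i < θ.ord ∧ κ = #(Y i)} θ

namespace IsLargeTail

variable {γ : Ordinal.{u} → Ordinal.{u}} {Y : Ordinal.{u} → Set M}

theorem exists_lt_mk (h : IsLargeTail θ F γ Y) (hF : ∀ β < θ.ord, #(F ⁻¹' Set.Iic β) < θ)
    {κ : Cardinal.{u}} (hκ : κ < θ) {j : Ordinal.{u}} (hj1 : 1 ≤ j) (hj : j < θ.ord) :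
    ∃ i, j < i ∧ i < θ.ord ∧ κ < #(Y i) := by
  obtain ⟨_, ⟨i, hi1, hi, rfl⟩, hlt⟩ :=
    (lt_isLUB_iff h.isLUB).1 (max_lt hκ (hF (γ j) (h.lt j hj1 hj)))
  refine ⟨i, ?_, hi, (le_max_left _ _).trans_lt hlt⟩
  by_contra! hij
  have hγij : γ i ≤ γ j :=
    hij.eq_or_lt.elim (fun hij => hij ▸ le_rfl) fun hij => (h.increasing i j hi1 hij hj).le
  refine ((le_max_right _ _).trans_lt hlt).not_ge (mk_le_mk_of_subset fun a ha => ?_)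
  exact (h.subset i hi1 hi ha).trans_le hγij

theorem shift (h : IsLargeTail θ F γ Y) (hθ : ℵ₀ ≤ θ) (hF : ∀ β < θ.ord, #(F ⁻¹' Set.Iic β) < θ)
    {j : Ordinal.{u}} (hj1 : 1 ≤ j) (hj : j < θ.ord) :
    IsLargeTail θ F (fun i => γ (j + i)) (fun i => Y (j + i)) := by
  have hadd : ∀ {i}, i < θ.ord → j + i < θ.ord := fun hi => Ordinal.isPrincipal_add_ord hθ hj hi
  have hadd1 : ∀ {i}, 1 ≤ j + i := hj1.trans le_self_add
  refine ⟨fun i _ hi => h.lt _ hadd1 (hadd hi), fun i i' _ hii' hi' =>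
    h.increasing _ _ hadd1 (by gcongr) (hadd hi'), fun i _ hi => h.subset _ hadd1 (hadd hi), ?_, ?_⟩
  · rintro _ ⟨i, _, hi, rfl⟩
    exact h.isLUB.1 ⟨j + i, hadd1, hadd hi, rfl⟩
  · intro κ hκ
    by_contra! hκθ
    obtain ⟨i, hji, hi, hlt⟩ := h.exists_lt_mk hF hκθ hj1 hj
    refine hlt.not_ge (hκ ⟨i - j, ?_, (Ordinal.sub_le_self i j).trans_lt hi, ?_⟩)
    · exact Order.one_le_iff_pos.2 (Ordinal.lt_sub.2 (by rwa [add_zero]))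
    · rw [Ordinal.add_sub_cancel_of_le hji.le]

theorem lt_add (h : IsLargeTail θ F γ Y) (hθ : ℵ₀ ≤ θ) {i j : Ordinal.{u}} (hj1 : 1 ≤ j)
    (hj : j < θ.ord) (hi1 : 1 ≤ i) (hi : i < θ.ord) : γ j < γ (j + i) :=
  h.increasing j _ hj1 (lt_add_of_pos_right j (zero_lt_one.trans_le hi1))
    (Ordinal.isPrincipal_add_ord hθ hj hi)

end IsLargeTail

variable [LinearOrder M]

theorem forall_fin_sub_iff {P : Fin s → Prop} :
    (∀ k : Fin (s - e), P ⟨e + k, by omega⟩) ↔ ∀ i : Fin s, e ≤ i → P i := by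
  refine ⟨fun h i hi => ?_, fun h k => h _ (Nat.le_add_right e k)⟩
  simpa only [Nat.add_sub_cancel' hi] using h ⟨i - e, by omega⟩

theorem mem_rowProduct {X : Fin e → Set M} {A : Set M} {x : Fin s → Fin r → M} :
    x ∈ rowProduct F X A ↔ (∀ i, StrictMono (x i)) ∧
      (∀ (i : Fin s) (hi : i.val < e) (j), x i j ∈ X ⟨i, hi⟩) ∧
      ∀ i : Fin s, e ≤ i → (∀ j l, F (x i j) = F (x i l)) ∧
        (∀ i' j l, i < i' → F (x i j) < F (x i' l)) ∧ ∀ j, x i j ∈ A := by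
  constructor
  · rintro ⟨hhead, ⟨hmono, hconst, hinc⟩, hA⟩
    rw [forall_fin_sub_iff (P := fun i => StrictMono (x i))] at hmono
    rw [forall_fin_sub_iff (P := fun i => ∀ j l, F (x i j) = F (x i l))] at hconst
    rw [forall_fin_sub_iff (P := fun i => ∀ j, x i j ∈ A)] at hA
    refine ⟨fun i => ?_, fun i hi => (hhead i hi).2, fun i hi => ⟨hconst i hi, ?_, hA i hi⟩⟩
    · exact (lt_or_ge i.val e).elim (fun hi => (hhead i hi).1) (hmono i)
    · intro i' j l hii'
      have := hinc ⟨i - e, by omega⟩ ⟨i' - e, by omega⟩ j l (by simp only [Fin.lt_def] at *; omega)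
      simpa only [Nat.add_sub_cancel' hi, Nat.add_sub_cancel' (hi.trans hii'.le)] using this
  · rintro ⟨hmono, hhead, htail⟩
    have hle : ∀ k : Fin (s - e), e ≤ e + k := fun k => Nat.le_add_right e k
    exact ⟨fun i hi => ⟨hmono i, hhead i hi⟩, ⟨fun k => hmono _, fun k => (htail _ (hle k)).1,
      fun k k' j l hkk => (htail _ (hle k)).2.1 _ j l (Nat.add_lt_add_left hkk e)⟩,
      fun k => (htail _ (hle k)).2.2⟩

theorem rowProduct_mono_left {X X' : Fin e → Set M} (h : ∀ k, X k ⊆ X' k) (A : Set M) :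
    rowProduct (r := r) (s := s) F X A ⊆ rowProduct F X' A :=
  fun _ hx => ⟨fun i hi => ⟨(hx.1 i hi).1, fun j => h _ ((hx.1 i hi).2 j)⟩, hx.2⟩

theorem rowProduct_snoc_subset {X : Fin e → Set M} {Z A A' : Set M} {β : Ordinal.{u}}
    (hZ : Z ⊆ A ∩ F ⁻¹' {β}) (hA' : A' ⊆ A ∩ F ⁻¹' Set.Ioi β) :
    rowProduct (r := r) (s := s) F (Fin.snoc X Z : Fin (e + 1) → Set M) A' ⊆ rowProduct F X A := by
  intro x hx
  obtain ⟨hmono, hhead, htail⟩ := mem_rowProduct.1 hx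
  have hrow : ∀ i : Fin s, i.val = e → ∀ j, x i j ∈ Z := fun i hi j => by
    have := hhead i (by omega) j
    rwa [show (⟨i, by omega⟩ : Fin (e + 1)) = Fin.last e from Fin.ext hi, Fin.snoc_last] at this
  refine mem_rowProduct.2 ⟨hmono, fun i hi j => ?_, fun i hi => ?_⟩
  · have := hhead i (hi.trans e.lt_succ_self) j
    rwa [show (⟨i, hi.trans e.lt_succ_self⟩ : Fin (e + 1)) = Fin.castSucc ⟨i, hi⟩ from rfl,
      Fin.snoc_castSucc] at this
  obtain hie | hie := hi.eq_or_lt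
  · have hβ : ∀ j, F (x i j) = β := fun j => (hZ (hrow i hie.symm j)).2
    refine ⟨fun j l => (hβ j).trans (hβ l).symm, fun i' j l hii' => ?_,
      fun j => (hZ (hrow i hie.symm j)).1⟩
    rw [hβ j]
    exact (hA' ((htail i' (hie ▸ hii')).2.2 l)).2
  · obtain ⟨hconst, hinc, hA⟩ := htail i hie
    exact ⟨hconst, hinc, fun j => (hA' (hA j)).1⟩

theorem IsLargeTail.rowProduct_shift_subset {γ : Ordinal.{u} → Ordinal.{u}}
    {Y : Ordinal.{u} → Set M} (h : IsLargeTail θ F γ Y) (hθ : ℵ₀ ≤ θ) {j : Ordinal.{u}}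
    (hj1 : 1 ≤ j) (hj : j < θ.ord) (X : Fin e → Set M) {Z : Set M} (hZ : Z ⊆ Y j) :
    rowProduct (r := r) (s := s) F (Fin.snoc X Z : Fin (e + 1) → Set M)
      (⋃ i ∈ {i : Ordinal.{u} | 1 ≤ i ∧ i < θ.ord}, Y (j + i)) ⊆
    rowProduct F X (⋃ i ∈ {i : Ordinal.{u} | 1 ≤ i ∧ i < θ.ord}, Y i) := by
  refine rowProduct_snoc_subset (β := γ j)
    (fun a ha => ⟨?_, h.subset j hj1 hj (hZ ha)⟩) fun a ha => ?_
  · exact Set.mem_iUnion₂.2 ⟨j, ⟨hj1, hj⟩, hZ ha⟩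
  · obtain ⟨i, ⟨hi1, hi⟩, ha⟩ := Set.mem_iUnion₂.1 ha
    have hmem : j + i ∈ {i | 1 ≤ i ∧ i < θ.ord} :=
      ⟨hj1.trans le_self_add, Ordinal.isPrincipal_add_ord hθ hj hi⟩
    refine ⟨Set.mem_iUnion₂.2 ⟨j + i, hmem, ha⟩, ?_⟩
    rw [Set.mem_preimage, h.subset _ hmem.1 hmem.2 ha]
    exact h.lt_add hθ hj1 hj hi1 hi

theorem strictMono_snoc {α : Type*} [Preorder α] {β : Fin e → α} (hβ : StrictMono β) {x : α}
    (hx : ∀ k, β k < x) : StrictMono (Fin.snoc β x : Fin (e + 1) → α) := by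
  intro k l
  refine Fin.lastCases (fun h => ?_) (fun k => Fin.lastCases (fun _ => ?_) (fun l h => ?_) l) k
  · exact absurd h l.le_last.not_gt
  · simpa using hx k
  · simpa using hβ (Fin.castSucc_lt_castSucc_iff.1 h)

theorem PlayerTwoWins.snoc (hθ : ℵ₀ ≤ θ) (hF : ∀ β < θ.ord, #(F ⁻¹' Set.Iic β) < θ)
    {S : Set (Fin s → Fin r → M)} {μ : Fin e → Cardinal.{u}} {β : Fin e → Ordinal.{u}}
    {γ : Ordinal.{u} → Ordinal.{u}} (h : PlayerTwoWins θ F e S μ β γ) {κ : Cardinal.{u}}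
    (hκ : κ < θ) :
    ∃ j, PlayerTwoWins θ F (e + 1) S (Fin.snoc μ κ : Fin (e + 1) → Cardinal.{u})
      (Fin.snoc β (γ j) : Fin (e + 1) → Ordinal.{u}) (fun i => γ (j + i)) := by
  obtain ⟨X, Y, hX, hY, hsup, hS⟩ := h.exists_sets
  have htail : IsLargeTail θ F γ Y := ⟨h.tail_lt, h.tail_increasing, hY, hsup⟩
  have h1 : (1 : Ordinal) < θ.ord := Ordinal.one_lt_omega0.trans_le (by rwa [omega0_le_ord])
  obtain ⟨j, hj1, hj, hκj⟩ := htail.exists_lt_mk hF hκ le_rfl h1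
  obtain ⟨Z, hZY, hZ⟩ := le_mk_iff_exists_subset.1 hκj.le
  have hshift := htail.shift hθ hF hj1.le hj
  exact ⟨j, {
    head_lt := Fin.lastCases (by simpa using h.tail_lt j hj1.le hj) (by simpa using h.head_lt)
    tail_lt := hshift.lt
    head_increasing := strictMono_snoc h.head_increasing fun k => h.head_lt_tail k j hj1.le hj
    head_lt_tail := fun k i hi1 hi => by
      refine Fin.lastCases ?_ (fun k => ?_) k
      · simpa using htail.lt_add hθ hj1.le hj hi1 hi
      · simpa using h.head_lt_tail k _ (hj1.le.trans le_self_add)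
          (Ordinal.isPrincipal_add_ord hθ hj hi)
    tail_increasing := hshift.increasing
    exists_sets := ⟨Fin.snoc X Z, fun i => Y (j + i),
      Fin.forall_fin_succ'.2 (by simpa using ⟨hX, hZY.trans (hY j hj1.le hj), hZ⟩),
      hshift.subset, hshift.isLUB, (htail.rowProduct_shift_subset hθ hj1.le hj X hZY).trans hS⟩ }⟩

/-- The strategy that follows `str` for the first `e` moves. Instead of the last move of `str`, it
plays the term of index `J μ κ` of that move, for the cardinals `μ` and `κ` played so far, and then
the terms after it. -/
noncomputable def Strategy.snoc (str : Strategy.{u} e)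
    (J : (Fin e → Cardinal.{u}) → Cardinal.{u} → Ordinal.{u}) : Strategy.{u} (e + 1) where
  head := Fin.lastCases (fun μ => str.tail (Fin.init μ) (J (Fin.init μ) (μ (Fin.last e)))) str.head
  tail μ i := str.tail (Fin.init μ) (J (Fin.init μ) (μ (Fin.last e)) + i)

theorem IsSuperlarge.succ (hθ : ℵ₀ ≤ θ) (hF : ∀ β < θ.ord, #(F ⁻¹' Set.Iic β) < θ) (he : e < s)
    {S : Set (Fin s → Fin r → M)} (hS : IsSuperlarge θ F e S) : IsSuperlarge θ F (e + 1) S := by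
  obtain ⟨-, -, hsub, str, hstr⟩ := hS
  have hsnoc := fun μ (hμ : ∀ k, μ k < θ) κ (hκ : κ < θ) => (hstr μ hμ).snoc hθ hF hκ
  choose! J hJ using hsnoc
  refine ⟨by omega, he, hsub, str.snoc J, fun μ hμ => ?_⟩
  have hwin := hJ (Fin.init μ) (fun k => hμ _) (μ (Fin.last e)) (hμ _)
  rw [Fin.snoc_init_self] at hwin
  refine Eq.subst (motive := fun β => PlayerTwoWins θ F (e + 1) S μ β _) (funext fun k => ?_) hwin
  refine Fin.lastCases ?_ (fun k => ?_) k
  · simp only [Strategy.snoc, Fin.lastCases_last, Fin.snoc_last]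
    rfl
  · simp only [Strategy.snoc, Fin.lastCases_castSucc, Fin.snoc_castSucc]
    rfl

theorem IsSuperlarge.of_le (hθ : ℵ₀ ≤ θ) (hF : ∀ β < θ.ord, #(F ⁻¹' Set.Iic β) < θ) {e' : ℕ}
    (he : e ≤ e') (he' : e' ≤ s) {S : Set (Fin s → Fin r → M)} (hS : IsSuperlarge θ F e S) :
    IsSuperlarge θ F e' S := by
  induction e', he using Nat.le_induction with
  | base => exact hS
  | succ k _ ih => exact (ih (by omega)).succ hθ hF he'

/-- The cardinals that II pretends I has played in order to have room for shrinking the sets later: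
in place of `μ k` it is the maximum of `μ k` and of the cardinals `Φ k (β i) (μ k)` for `i < k`,
where `β i` is the answer of `str` to the cardinals pretended up to `i`. -/
noncomputable def Strategy.pretend (str : Strategy.{u} e)
    (Φ : Fin e → Ordinal.{u} → Cardinal.{u} → Cardinal.{u}) (k : Fin e)
    (μ : Fin (k.val + 1) → Cardinal.{u}) : Cardinal.{u} :=
  max (μ (Fin.last k)) <| Finset.univ.sup fun i : Fin k.val =>
    Φ k (str.head (i.castLT (i.isLt.trans k.isLt)) fun q =>
      str.pretend Φ (q.castLT (by omega)) fun p => μ (p.castLE (by simp; omega))) (μ (Fin.last k))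
termination_by k.val
decreasing_by simp; omega

/-- The strategy that answers as `str` would answer to the cardinals `str.pretend Φ`. -/
noncomputable def Strategy.pretending (str : Strategy.{u} e)
    (Φ : Fin e → Ordinal.{u} → Cardinal.{u} → Cardinal.{u}) : Strategy.{u} e where
  head k μ := str.head k fun q =>
    str.pretend Φ (q.castLT (by omega)) fun p => μ (p.castLE (by simp; omega))
  tail μ := str.tail fun q => str.pretend Φ q fun p => μ (p.castLE q.isLt)

theorem IsSuperlarge.sep (hθ : θ ≠ 0) {S : Set (Fin s → Fin r → M)} (hS : IsSuperlarge θ F e S)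
    {Φ : Fin e → Ordinal.{u} → Cardinal.{u} → Cardinal.{u}} (hΦ : ∀ k α, ∀ m < θ, Φ k α m < θ)
    {P : (Fin s → Fin r → M) → Prop}
    (hshrink : ∀ (μ : Fin e → Cardinal.{u}) (β : Fin e → Ordinal.{u}) (X : Fin e → Set M),
      (∀ k, μ k < θ) → (∀ k, β k < θ.ord) → StrictMono β → (∀ k, X k ⊆ F ⁻¹' {β k}) →
      (∀ k, μ k ≤ #(X k)) → (∀ k, ∀ i < k, Φ k (β i) (μ k) ≤ #(X k)) →
      ∃ H : Fin e → Set M, (∀ k, H k ⊆ X k ∧ #(H k) = μ k) ∧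
        ∀ A, ∀ a ∈ rowProduct F H A, P a) :
    IsSuperlarge θ F e {a ∈ S | P a} := by
  obtain ⟨he, hes, hsub, str, hstr⟩ := hS
  refine ⟨he, hes, fun a ha => hsub ha.1, str.pretending Φ, fun μ hμ => ?_⟩
  let ν (k : Fin e) : Cardinal.{u} := str.pretend Φ k fun p => μ (p.castLE k.isLt)
  let β (k : Fin e) : Ordinal.{u} := str.head k fun q => ν (q.castLE k.isLt)
  have hν (k : Fin e) : ν k =
      max (μ k) (Finset.univ.sup fun i : Fin k.val => Φ k (β (i.castLT (by omega))) (μ k)) := by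
    simp only [ν]
    rw [Strategy.pretend]
    rfl
  have hνθ : ∀ k, ν k < θ := fun k => by
    rw [hν, max_lt_iff, Finset.sup_lt_iff (bot_lt_iff_ne_bot.2 hθ)]
    exact ⟨hμ k, fun i _ => hΦ k _ _ (hμ k)⟩
  have hwin : PlayerTwoWins θ F e S ν β (str.tail ν) := hstr ν hνθ
  obtain ⟨X, Y, hX, hY, hsup, hS⟩ := hwin.exists_sets
  obtain ⟨H, hH, hP⟩ := hshrink μ β X hμ hwin.head_lt hwin.head_increasing (fun k => (hX k).1)
    (fun k => by rw [(hX k).2, hν]; exact le_max_left _ _) fun k i hik => by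
      rw [(hX k).2, hν]
      exact le_max_of_le_right <| Finset.le_sup
        (f := fun i : Fin k.val => Φ k (β (i.castLT (by omega))) (μ k))
        (Finset.mem_univ (⟨i, hik⟩ : Fin k.val))
  exact { hwin with
    exists_sets := ⟨H, Y, fun k => ⟨(hH k).1.trans (hX k).1, (hH k).2⟩, hY, hsup, fun a ha =>
      ⟨hS (rowProduct_mono_left (fun k => (hH k).1) _ ha), hP _ a ha⟩⟩ }

end Game

section HomogeneousGame

variable {M : Type u} [LinearOrder M] {I : Type} [LinearOrder I] {r s e : ℕ} {row : I → Fin e}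

theorem IsRowIncreasing.entries {col : I → Fin r} (hcol : IsRowIncreasing row col)
    {a : Fin e → Fin r → M} (ha : ∀ k, StrictMono (a k)) :
    IsRowIncreasing row fun q => a (row q) (col q) := by
  rintro _ q rfl q' (hqq' : row q' = row q) hlt
  simpa only [hqq'] using ha (row q) (hcol _ rfl hqq' hlt)

theorem IsSuperlarge.sep_homogeneous [Finite I] {θ : Cardinal.{u}} (hθ : θ.IsStrongLimit)
    {F : M → Ordinal.{u}} (hFmono : Monotone F) (hF : ∀ β < θ.ord, #(F ⁻¹' Set.Iic β) < θ)
    {S : Set (Fin s → Fin r → M)} (hS : IsSuperlarge θ F e S) (row : I → Fin e) (u : Fin e)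
    (t : (I → M) → M) :
    IsSuperlarge θ F e {a ∈ S | ∀ left right : I → Fin r,
      IsRowIncreasing row left → IsRowIncreasing row right →
      (∀ q, row q ≤ u → left q = right q) → ∀ v,
        t (fun q => a ((row q).castLE hS.2.1) (left q)) < a (u.castLE hS.2.1) v →
          t (fun q => a ((row q).castLE hS.2.1) (left q)) =
            t fun q => a ((row q).castLE hS.2.1) (right q)} := by
  have := Fintype.ofFinite I
  have hbound : ∀ (k : Fin e) (α : Ordinal.{u}), ∀ m < θ, ∃ μ < θ, α < θ.ord →
      ∀ D ⊆ F ⁻¹' Set.Iic α, PartitionArrow μ m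
        #(({q // row q < k} → F ⁻¹' Set.Iic α) → Option D)
        (Finset.univ.filter (row · = k)).card := by
    intro k α m hm
    by_cases hα : α < θ.ord
    · obtain ⟨μ, hμ, h⟩ := exists_partitionArrow_option hθ hm {q // row q < k} (hF α hα)
        (Finset.univ.filter (row · = k)).card
      exact ⟨μ, hμ, fun _ => h⟩
    · exact ⟨m, hm, fun h => absurd h hα⟩
  choose! Φ hΦθ hΦ using hbound
  refine hS.sep hθ.ne_zero hΦθ fun μ β X hμ hβθ hβ hX hμX hΦX => ?_
  have hpred : ∀ k, u < k → ∃ k' < k, u ≤ k' ∧ ∀ i < k, i ≤ k' := fun k hk =>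
    ⟨⟨k - 1, by omega⟩, by grind, by grind, by grind⟩
  obtain ⟨H, hH, hhom⟩ := exists_homogeneous_term (row := row) (u := u) t
    (D := F ⁻¹' Set.Iic (β u)) hμX fun k huk => by
      obtain ⟨k', hk', huk', hmax⟩ := hpred k huk
      refine ⟨F ⁻¹' Set.Iic (β k'), fun i hi x hx => ?_, ?_⟩
      · exact (hX i hx).le.trans (hβ.monotone (hmax i hi))
      · exact (hΦ k (β k') (μ k) (hμ k) (hβθ k') _
          (Set.preimage_mono (Set.Iic_subset_Iic.2 (hβ.monotone huk')))).mono (hΦX k k' hk') le_rfl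
  refine ⟨H, hH, fun A a ha left right hleft hright hagree v hlt => ?_⟩
  obtain ⟨hainc, haH, -⟩ := mem_rowProduct.1 ha
  have hmem (k : Fin e) (j : Fin r) : a (k.castLE hS.2.1) j ∈ H k :=
    haH (k.castLE hS.2.1) k.isLt j
  refine hhom _ _ (fun q => hmem _ _) (fun q => hmem _ _)
    (hleft.entries fun k => hainc (k.castLE hS.2.1))
    (hright.entries fun k => hainc (k.castLE hS.2.1)) (fun q hq => by rw [hagree q hq]) ?_
  exact (hFmono hlt.le).trans (hX u ((hH u).1 (hmem u v))).le

end HomogeneousGame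

section Sentences

open FirstOrder.Language

variable {LS : FirstOrder.Language.{v', w'}} {M : Type u} [LS.Structure M]

theorem realize_substConstants {n : ℕ} (τ : LS.Term (Fin n)) (p : Fin n → ℕ × ℕ) (c : ℕ × ℕ → M)
    (v : Empty ⊕ Fin 0 → M) :
    letI := constantsOn.structure c
    (substConstants τ p).realize v = τ.realize fun k => c (p k) := by
  let := constantsOn.structure c
  rw [substConstants, Term.realize_subst, LHom.realize_onTerm]
  exact congrArg τ.realize (funext fun k => Term.realize_constants)

variable [LinearOrder M] {lt : LS.Relations 2} {r s : ℕ}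

theorem isRowIncreasing_of_strictMono_toLex {n e : ℕ} {p : Fin n → ℕ × ℕ}
    (hp : StrictMono fun q => toLex (p q)) {row : Fin n → Fin e} {col : Fin n → Fin r}
    (h : ∀ q, p q = ((row q).val + 1, (col q).val + 1)) : IsRowIncreasing row col := by
  rintro _ q rfl q' (hqq' : row q' = row q) hlt
  have := Prod.Lex.lt_iff.1 (hp hlt)
  simp only [ofLex_toLex, h, hqq', lt_irrefl, true_and, false_or] at this
  exact Nat.succ_lt_succ_iff.1 this

namespace SigmaIV

variable {σ : SigmaIV LS}

theorem holds_iff (hlt : ∀ a b : M, Structure.RelMap lt ![a, b] ↔ a < b) (a : Fin s → Fin r → M) :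
    Holds (σ.sentence lt) a ↔
      ∀ c : ℕ × ℕ → M, (∀ (i : Fin s) (j : Fin r), c (i.val + 1, j.val + 1) = a i j) →
        (σ.τ.realize fun k => c (σ.leftIndex k)) < c (σ.u, σ.v) →
          (σ.τ.realize fun k => c (σ.leftIndex k)) = σ.τ.realize fun k => c (σ.rightIndex k) := by
  refine forall_congr' fun c => forall_congr' fun _ => ?_
  let := constantsOn.structure c
  have hcon : ∀ v : Empty ⊕ Fin 0 → M, (LS.con (σ.u, σ.v)).term.realize v = c (σ.u, σ.v) :=
    fun v => Term.realize_constants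
  rw [Sentence.Realize, SigmaIV.sentence, Formula.Realize, BoundedFormula.realize_imp,
    BoundedFormula.realize_rel₂, BoundedFormula.realize_bdEqual, realize_substConstants,
    realize_substConstants, hcon, LHom.map_onRelation, hlt]

theorem i_le_iota (q : Fin (σ.n + 1)) : σ.i q ≤ σ.iota :=
  (Fin.le_last q).eq_or_lt.elim (fun h => (congrArg σ.i h).le) fun h =>
    (Prod.Lex.lt_iff.1 (σ.left_increasing h)).elim le_of_lt fun h => h.1.le

variable (σ r) in
/-- The positions of the constants of `σ` in a matrix with rows and columns numbered from `0`:
the `q`-th constants of the left and the right sequence are in the columns `left q` and `right q`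
of the row `row q`, and `c_{uv}` is in the column `v` of the row `u`. -/
structure Positions where
  row : Fin (σ.n + 1) → Fin σ.iota
  left : Fin (σ.n + 1) → Fin r
  right : Fin (σ.n + 1) → Fin r
  u : Fin σ.iota
  v : Fin r
  leftIndex_eq : ∀ q, σ.leftIndex q = ((row q).val + 1, (left q).val + 1)
  rightIndex_eq : ∀ q, σ.rightIndex q = ((row q).val + 1, (right q).val + 1)
  uv_eq : (σ.u, σ.v) = (u.val + 1, v.val + 1)

theorem InRange.nonempty_positions (hσ : σ.InRange r s) : Nonempty (σ.Positions r) := by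
  have hi : ∀ q, ∃ k : Fin σ.iota, σ.i q = k.val + 1 := fun q =>
    ⟨⟨σ.i q - 1, by have := σ.i_pos q; have := σ.i_le_iota q; omega⟩,
      (Nat.sub_add_cancel (σ.i_pos q)).symm⟩
  have hcol : ∀ m, 1 ≤ m → m ≤ r → ∃ j : Fin r, m = j.val + 1 := fun m hm hmr =>
    ⟨⟨m - 1, by omega⟩, (Nat.sub_add_cancel hm).symm⟩
  have hright : ∀ q, 1 ≤ (σ.rightIndex q).2 := fun q => by
    rw [rightIndex]
    split_ifs
    exacts [σ.j_pos q, σ.l_pos q]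
  choose row hrow using hi
  choose left hleft using fun q => hcol _ (σ.j_pos q) (hσ.1 q).2
  choose right hright using fun q => hcol _ (hright q) (hσ.2.1 q).2
  obtain ⟨v, hv⟩ := hcol _ σ.v_pos hσ.2.2.2
  have hu : σ.u < σ.iota := σ.u_lt
  exact ⟨{
    row, left, right, v
    u := ⟨σ.u - 1, by omega⟩
    leftIndex_eq := fun q => Prod.ext (hrow q) (hleft q)
    rightIndex_eq := fun q => Prod.ext (hrow q) (hright q)
    uv_eq := Prod.ext (Nat.sub_add_cancel σ.u_pos).symm hv }⟩

namespace Positions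

variable (κ : σ.Positions r)

theorem isRowIncreasing_left : IsRowIncreasing κ.row κ.left :=
  isRowIncreasing_of_strictMono_toLex σ.left_increasing κ.leftIndex_eq

theorem isRowIncreasing_right : IsRowIncreasing κ.row κ.right :=
  isRowIncreasing_of_strictMono_toLex σ.right_increasing κ.rightIndex_eq

theorem left_eq_right {q : Fin (σ.n + 1)} (hq : κ.row q ≤ κ.u) : κ.left q = κ.right q := by
  have hl := κ.leftIndex_eq q
  have hr := κ.rightIndex_eq q
  have hu := κ.uv_eq
  rw [leftIndex, Prod.mk.injEq] at hl
  rw [Prod.mk.injEq] at hu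
  rw [rightIndex, if_pos (by rw [hl.1, hu.1]; exact Nat.succ_le_succ hq), hl.2,
    Prod.mk.injEq] at hr
  exact Fin.ext (Nat.succ_injective hr.2)

theorem holds (hlt : ∀ a b : M, Structure.RelMap lt ![a, b] ↔ a < b) (hs : σ.iota ≤ s)
    {a : Fin s → Fin r → M}
    (ha : σ.τ.realize (fun q => a ((κ.row q).castLE hs) (κ.left q)) < a (κ.u.castLE hs) κ.v →
      σ.τ.realize (fun q => a ((κ.row q).castLE hs) (κ.left q)) =
        σ.τ.realize fun q => a ((κ.row q).castLE hs) (κ.right q)) :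
    Holds (σ.sentence lt) a := by
  refine (σ.holds_iff hlt a).2 fun c hc => ?_
  have hca : ∀ (k : Fin σ.iota) (j : Fin r), c (k.val + 1, j.val + 1) = a (k.castLE hs) j :=
    fun k j => hc (k.castLE hs) j
  simpa only [κ.leftIndex_eq, κ.rightIndex_eq, κ.uv_eq, hca] using ha

end Positions

end SigmaIV

end Sentences

section Chain

variable {L : FirstOrder.Language.{v, w}} {LS : FirstOrder.Language.{v', w'}} {ι : L →ᴸ LS}
  {M : Type u} [LinearOrder M] [L.Structure M] [LS.Structure M] [ι.IsExpansionOn M]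
  {θ : Cardinal.{u}} {N : Ordinal.{u} → LS.Substructure M}

namespace IsElementaryEndChain

theorem mono (hN : IsElementaryEndChain ι θ N) {i j : Ordinal.{u}} (hij : i ≤ j)
    (hj : j < θ.ord) : N i ≤ N j :=
  hij.eq_or_lt.elim (fun h => h ▸ le_rfl) fun h => (hN.strictMono i j h hj).le

theorem rank_spec (hN : IsElementaryEndChain ι θ N) (a : M) :
    rank θ N a < θ.ord ∧ a ∈ N (rank θ N a) :=
  csInf_mem (s := {i | i < θ.ord ∧ a ∈ N i}) (hN.exhausts a)

theorem rank_le_iff (hN : IsElementaryEndChain ι θ N) {i : Ordinal.{u}} (hi : i < θ.ord) (a : M) :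
    rank θ N a ≤ i ↔ a ∈ N i :=
  ⟨fun h => hN.mono h hi (hN.rank_spec a).2, fun h => csInf_le' ⟨hi, h⟩⟩

theorem monotone_rank (hN : IsElementaryEndChain ι θ N) : Monotone (rank θ N) := by
  intro b a hba
  obtain ⟨ha, haN⟩ := hN.rank_spec a
  obtain ⟨hb, hbN⟩ := hN.rank_spec b
  by_contra! h
  have hbN' : b ∉ N (rank θ N a) := fun hb' => h.not_ge ((hN.rank_le_iff ha b).2 hb')
  exact hba.not_gt (hN.endExtension _ _ h hb a haN b hbN hbN')

theorem mk_rank_preimage_Iic_lt (hN : IsElementaryEndChain ι θ N) (hθ : ℵ₀ ≤ θ)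
    (hM : ∀ a : M, #(Set.Iio a) < θ) {i : Ordinal.{u}} (hi : i < θ.ord) :
    #(rank θ N ⁻¹' Set.Iic i) < θ := by
  have hi' : Order.succ i < θ.ord := (isSuccLimit_ord hθ).succ_lt hi
  obtain ⟨b, hb, hbi⟩ := SetLike.exists_of_lt (hN.strictMono i _ (Order.lt_succ i) hi')
  refine (mk_le_mk_of_subset fun a ha => ?_).trans_lt (hM b)
  exact hN.endExtension i _ (Order.lt_succ i) hi' a ((hN.rank_le_iff hi a).1 ha) b hb hbi

end IsElementaryEndChain

end Chain

end KeislerModels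

theorem proposition4p3_general {LS : FirstOrder.Language.{v', w'}} {M : Type u} [LinearOrder M]
    [LS.Structure M] (lt : LS.Relations 2)
    (hlt : ∀ a b : M, FirstOrder.Language.Structure.RelMap lt ![a, b] ↔ a < b)
    (θ : Cardinal.{u}) (hθ : θ.IsStrongLimit) (F : M → Ordinal.{u}) (hFmono : Monotone F)
    (hF : ∀ β < θ.ord, #(F ⁻¹' Set.Iic β) < θ) (r s e : ℕ) (S : Set (Fin s → Fin r → M))
    (hS : KeislerModels.IsSuperlarge θ F e S)
    (σ : KeislerModels.SigmaIV LS) (hσ : σ.InRange r s) (he : e ≤ σ.iota) :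
    ∃ S' ⊆ S, KeislerModels.IsSuperlarge θ F σ.iota S' ∧
      ∀ a ∈ S', KeislerModels.Holds (σ.sentence lt) a := by
  have hs : σ.iota ≤ s := (hσ.1 _).1
  obtain ⟨κ⟩ := hσ.nonempty_positions
  have hhom := (hS.of_le hθ.aleph0_le hF he hs).sep_homogeneous hθ hFmono hF κ.row κ.u σ.τ.realize
  exact ⟨_, Set.sep_subset _ _, hhom, fun a ha => κ.holds hlt hs <|
    ha.2 κ.left κ.right κ.isRowIncreasing_left κ.isRowIncreasing_right
      (fun _ => κ.left_eq_right) κ.v⟩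

theorem proposition4p3
    {L : FirstOrder.Language.{v, w}} [Countable L.Symbols] {LS : FirstOrder.Language.{v', w'}} (ι : L →ᴸ LS)
    (lt : L.Relations 2)
    {M : Type u} [LinearOrder M] [L.Structure M] [LS.Structure M] [ι.IsExpansionOn M]
    (hlt : ∀ a b : M, FirstOrder.Language.Structure.RelMap lt ![a, b] ↔ a < b)
    (hSkolem : KeislerModels.HasSkolemFunctions ι M)
    (θ : Cardinal.{u}) (hθ : θ.IsInaccessible) (hM : KeislerModels.IsLike θ M)
    (N : Ordinal.{u} → LS.Substructure M) (hN : KeislerModels.IsElementaryEndChain ι θ N)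
    (r s : ℕ) (hr : 1 ≤ r) (hs : 1 ≤ s) (e e' : ℕ)
    (S : Set (Fin s → Fin r → M))
    (hS : KeislerModels.IsSuperlarge θ (KeislerModels.rank θ N) e S)
    (σ : KeislerModels.SigmaIV LS) (hσ : σ.InRange r s) (hι : σ.iota = e') (he : e ≤ e') :
    ∃ S' ⊆ S, KeislerModels.IsSuperlarge θ (KeislerModels.rank θ N) e' S' ∧
      ∀ a ∈ S', KeislerModels.Holds (σ.sentence (ι.onRelation lt)) a := by
  subst hι
  exact proposition4p3_general _ (fun a b => by rw [FirstOrder.Language.LHom.map_onRelation, hlt])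
    θ hθ.isStrongLimit _ hN.monotone_rank
    (fun _ => hN.mk_rank_preimage_Iic_lt hθ.aleph0_lt.le hM.2) r s e S hS σ hσ he
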